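/- Let $K$ and $n\ge 1$ be integers. The $K$-user symbol collision channel of order $n$ is the memoryless channel in which each user has input alphabet $\{0,1,\dots,2^n\}$ ($0$ is the idle symbol), and the output alphabet is $\{0,1,\dots,2^n,c\}$: the output is $0$ if all users send $0$, it is $X_k$ if user $k$ alone sends a nonzero symbol $X_k$, and it is the collision symbol $c$ if at least two users send nonzero symbols. Let $R_{\max}>0$. For codeword length $N$, each user has the messages $W\in\{1,\dots,\lfloor 2^{NR_{\max}}\rfloor\}$; the standard rate of $W$ is $r(W)=\frac1N\log_2 W$. Each user $k$ has a library of codebooks $\{\mathcal C_\theta\}$ and draws the index $\theta$ at random (independently of the other users) so that the symbols $[\mathcal C_\theta(W)]_j$, over all messages $W$ and positions $j\le N$, are independent, and $[\mathcal C_\theta(W)]_j$ has the distribution $P_{X_k|r}$ with $r=r(W)$, where $$P_{X_k|r}(0)=1-p(r),\qquad P_{X_k|r}(x)=\frac{1}{2^n}\,p(r)\quad (1\le x\le 2^n),\qquad p(r)=\sqrt{r/n}$$ for $0\le r\le n$ (if $R_{\max}>n$, put $p(r)=1$ for $r>n$). The receiver knows the codebooks of all users; from the $N$ channel outputs it either estimates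 the vector of all messages or reports a collision. Let $P_e(\mathbf W)$ be the probability, over the codebooks and the channel, that the receiver does not output the sent message vector $\mathbf W$, and $P_c(\mathbf W)$ the probability that it reports a collision. Then the rate region $$\mathbf R=\Big\{\mathbf r\in[0,\infty)^K : \sum_{k=1}^K\sqrt{r_k/n}<1\Big\}$$ is asymptotically achievable: there is a sequence of decoders, one for each $N$, such that (1) $P_e(\mathbf W^{(N)})\to 0$ for every sequence of message vectors $\mathbf W^{(N)}$ whose rate vectors lie in $\mathbf R$ for all large $N$ and converge to a point of $\mathbf R$; (2) $P_c(\mathbf W^{(N)})\to 1$ for every sequence of message vectors $\mathbf W^{(N)}$ whose rate vectors lie outside the closure of $\mathbf R$ for all large $N$ and converge to a point outside that closure. -/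

import Mathlib

open MeasureTheory ProbabilityTheory Filter Topology

universe u

namespace RandomAccess

/-! ### Messages and standard rates -/

/-- Number of codewords `2 ^ (N * Rmax)` (rounded down to an integer) in a codebook of length `N`. -/
noncomputable def numMessages (Rmax : ℝ) (N : ℕ) : ℕ := ⌊(2 : ℝ) ^ ((N : ℝ) * Rmax)⌋₊

/-- Messages `1, …, 2 ^ (N * Rmax)`; the element `w` of `Fin _` stands for the message `w + 1`. -/
abbrev Message (Rmax : ℝ) (N : ℕ) : Type := Fin (numMessages Rmax N)

/-- The standard communication rate `(1 / N) * log₂ W`, in bits per symbol. -/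
noncomputable def stdRate {Rmax : ℝ} {N : ℕ} (W : Message Rmax N) : ℝ :=
  Real.logb 2 (((W : ℕ) : ℝ) + 1) / (N : ℝ)

/-- The vector of standard rates of a vector of messages. -/
noncomputable def rateVec {K : ℕ} {Rmax : ℝ} {N : ℕ} (W : Fin K → Message Rmax N) :
    Fin K → ℝ :=
  fun k => stdRate (W k)

/-! ### Random coding -/

/-- A codebook: a codeword of length `N` over the input alphabet `A` for each message. -/
abbrev Codebook (A : Type) (Rmax : ℝ) (N : ℕ) : Type := Message Rmax N → Fin N → A

/-- A generalized random coding scheme: a library of codebooks indexed by `Θ`, with a probability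
distribution `γ` of the index, such that the symbols `θ ↦ [C_θ(W)]_j` are independent over all
`W` and `j`, with distribution `P W`. -/
structure GenRandomCoding (A : Type) [MeasurableSpace A] (Rmax : ℝ) (N : ℕ)
    (P : Message Rmax N → PMF A) where
  /-- index set of the library -/
  Θ : Type u
  [measΘ : MeasurableSpace Θ]
  /-- distribution of the codebook index -/
  γ : Measure Θ
  [probγ : IsProbabilityMeasure γ]
  /-- the library of codebooks -/
  book : Θ → Codebook A Rmax N
  measurable_symbol : ∀ W j, Measurable fun θ => book θ W j
  indep : iIndepFun (fun (p : Message Rmax N × Fin N) (θ : Θ) => book θ p.1 p.2) γ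
  law : ∀ W j, γ.map (fun θ => book θ W j) = (P W).toMeasure

attribute [instance] GenRandomCoding.measΘ GenRandomCoding.probγ

/-! ### Channel, decoder, error and collision probabilities -/

/-- A `K`-user memoryless channel with input alphabet `A` (for each user) and output alphabet `B`:
the distribution of the output symbol for each vector of input symbols. -/
abbrev Channel (A B : Type) (K : ℕ) : Type := (Fin K → A) → PMF B

/-- Probability of the output sequence `y` when user `k` sends the codeword `x k`. -/
noncomputable def outputProb {A B : Type} {K N : ℕ} (ch : Channel A B K)
    (x : Fin K → Fin N → A) (y : Fin N → B) : ℝ :=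
  ∏ j, (ch (fun k => x k j) (y j)).toReal

/-- A decoder knows the codebooks of all users; from the output sequence it either estimates the
messages of all users (`some W`) or reports a collision (`none`). -/
abbrev Decoder (A B : Type) (K : ℕ) (Rmax : ℝ) (N : ℕ) : Type :=
  (Fin K → Codebook A Rmax N) → (Fin N → B) → Option (Fin K → Message Rmax N)

open Classical in
/-- Probability, for given codebooks, that the decoder does not recover the message vector `W`. -/
noncomputable def condErrorProb {A B : Type} [Fintype B] {K N : ℕ} {Rmax : ℝ}
    (ch : Channel A B K) (dec : Decoder A B K Rmax N) (C : Fin K → Codebook A Rmax N)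
    (W : Fin K → Message Rmax N) : ℝ :=
  ∑ y : Fin N → B, if dec C y ≠ some W then outputProb ch (fun k => C k (W k)) y else 0

open Classical in
/-- Probability, for given codebooks, that the decoder reports a collision when `W` is sent. -/
noncomputable def condCollisionProb {A B : Type} [Fintype B] {K N : ℕ} {Rmax : ℝ}
    (ch : Channel A B K) (dec : Decoder A B K Rmax N) (C : Fin K → Codebook A Rmax N)
    (W : Fin K → Message Rmax N) : ℝ :=
  ∑ y : Fin N → B, if dec C y = none then outputProb ch (fun k => C k (W k)) y else 0

/-- Unconditional error probability; the users draw their codebook indices independently. -/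
noncomputable def errorProb {A B : Type} [MeasurableSpace A] [Fintype B] {K N : ℕ} {Rmax : ℝ}
    {P : Fin K → Message Rmax N → PMF A} (ch : Channel A B K)
    (S : ∀ k, GenRandomCoding.{u} A Rmax N (P k)) (dec : Decoder A B K Rmax N)
    (W : Fin K → Message Rmax N) : ℝ :=
  ∫ θ, condErrorProb ch dec (fun k => (S k).book (θ k)) W ∂(Measure.pi fun k => (S k).γ)

/-- Unconditional collision probability. -/
noncomputable def collisionProb {A B : Type} [MeasurableSpace A] [Fintype B] {K N : ℕ} {Rmax : ℝ}
    {P : Fin K → Message Rmax N → PMF A} (ch : Channel A B K)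
    (S : ∀ k, GenRandomCoding.{u} A Rmax N (P k)) (dec : Decoder A B K Rmax N)
    (W : Fin K → Message Rmax N) : ℝ :=
  ∫ θ, condCollisionProb ch dec (fun k => (S k).book (θ k)) W ∂(Measure.pi fun k => (S k).γ)

/-- The region `R` of standard rate vectors is asymptotically achievable with the sequence `S` of
coding schemes, when the messages of all users are to be recovered: some sequence of decoders has
error probability tending to `0` along all message sequences with rates, and limit rate, in `R`,
and collision probability tending to `1` along all message sequences with rates, and limit rate,
outside the closure of `R`. The rates are constrained for all large `N` only, which covers more
message sequences than a constraint for all `N`. -/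
def IsAsymptoticallyAchievable {A B : Type} [MeasurableSpace A] [Fintype B] {K : ℕ} {Rmax : ℝ}
    {P : ∀ N, Fin K → Message Rmax N → PMF A} (ch : Channel A B K)
    (S : ∀ N k, GenRandomCoding.{u} A Rmax N (P N k)) (R : Set (Fin K → ℝ)) : Prop :=
  ∃ dec : ∀ N, Decoder A B K Rmax N,
    (∀ (W : ∀ N, Fin K → Message Rmax N) (r : Fin K → ℝ),
      (∀ᶠ N in atTop, rateVec (W N) ∈ R) →
      Tendsto (fun N => rateVec (W N)) atTop (𝓝 r) → r ∈ R →
      Tendsto (fun N => errorProb ch (S N) (dec N) (W N)) atTop (𝓝 0)) ∧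
    (∀ (W : ∀ N, Fin K → Message Rmax N) (r : Fin K → ℝ),
      (∀ᶠ N in atTop, rateVec (W N) ∉ closure R) →
      Tendsto (fun N => rateVec (W N)) atTop (𝓝 r) → r ∉ closure R →
      Tendsto (fun N => collisionProb ch (S N) (dec N) (W N)) atTop (𝓝 1))

/-! ### The symbol collision channel -/

/-- Input alphabet `{0, 1, …, 2 ^ n}`; `0` is the idle symbol. -/
abbrev InSymbol (n : ℕ) : Type := Fin (2 ^ n + 1)

/-- Output alphabet `{0, 1, …, 2 ^ n, c}`; the collision symbol `c` is `none`. -/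
abbrev OutSymbol (n : ℕ) : Type := Option (InSymbol n)

open Classical in
/-- The output symbol: idle if all users idle, the symbol of user `k` if only user `k` sends a
nonzero symbol, and a collision otherwise. -/
noncomputable def collisionOutput {K n : ℕ} (x : Fin K → InSymbol n) : OutSymbol n :=
  if ∀ k, x k = 0 then some 0
  else if h : ∃ k, x k ≠ 0 ∧ ∀ l, l ≠ k → x l = 0 then some (x h.choose)
  else none

/-- The `K`-user symbol collision channel of order `n`, a deterministic memoryless channel. -/
noncomputable def collisionChannel (K n : ℕ) : Channel (InSymbol n) (OutSymbol n) K :=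
  fun x => PMF.pure (collisionOutput x)

/-- Probability `√(r / n)` of a nonzero symbol at rate `r ≤ n`; it stays at `1` for `r > n`, where
`√(r / n)` is no probability. -/
noncomputable def activeProb (n : ℕ) (r : ℝ) : ℝ := min 1 (Real.sqrt (r / n))

/-- The input distribution at rate `r`: the symbol `0` has probability `1 - p(r)`, each of the
`2 ^ n` nonzero symbols has probability `p(r) / 2 ^ n`. -/
noncomputable def inputDist (n : ℕ) (r : ℝ) : PMF (InSymbol n) :=
  PMF.ofFintype
    (fun x => ENNReal.ofReal (if x = 0 then 1 - activeProb n r else 1 / 2 ^ n * activeProb n r))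
    (by
      have h1 : activeProb n r ≤ 1 := min_le_left _ _
      have h0 : 0 ≤ activeProb n r := le_min zero_le_one (Real.sqrt_nonneg _)
      rw [← ENNReal.ofReal_sum_of_nonneg]
      · rw [Fin.sum_univ_succ]
        simp [Fin.succ_ne_zero]
      · intro x _
        split_ifs
        · linarith
        · positivity)

/-- The rate region `{r : ∑ₖ √(rₖ / n) < 1}` (of vectors of nonnegative rates). -/
def collisionRegion (K n : ℕ) : Set (Fin K → ℝ) :=
  {r | (∀ k, 0 ≤ r k) ∧ ∑ k, Real.sqrt (r k / n) < 1}

end RandomAccess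

namespace RandomAccess

/-! Write `p_k` for the probability that user `k` is active. If `∑ p_k ≤ 1 - ε`, then by the union
bound user `k` is alone in a position with probability at least `p_k (p_k + ε)`. The decoder accepts
a vector when its probabilities satisfy this sum bound, it reproduces the output exactly, and each
user is alone in at least `N p_k (p_k + ε/2)` positions. A Chernoff bound shows that the sent vector
passes if its sum is at most `1 - ε` (`tableMeasure_real_not_accepts_self_le`).

For a wrong vector, each position where a user with a wrong message is alone matches the output with
conditional probability at most `2^(-n)`. Acceptance therefore has probability at most `2^(-n N ∑
p_k (p_k + ε/2))`, summed over the users with wrong messages (`tableMeasure_real_accepts_le`). Since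
`p = √(r/n)`, the quadratic part `2^(-n N p_k^2)` is exactly the reciprocal of the message number.
The union bound over all wrong vectors thus costs only a product of harmonic sums, polynomial in
`N`, while the linear part in `ε` gives decay exponential in `√N ε`, because `p_k ≥ 1/√(nN)` for
every message but the first. The first message has `p = 0`; if all wrong messages are the first, a
position where the wrong vector is idle but a true user is active refutes it
(`tableMeasure_real_accepts_le_exp`).

Outside the region `∑ p_k ≥ 1`, so the sent vector fails the sum bound, only wrong vectors could be
accepted, and a collision is reported. Letting `ε` tend to `0` slowly with `N` serves all limit
points with one sequence of decoders. -/

lemma dependsOn_prod {ι A κ : Type*} {S : κ → Set ι} {g : κ → (ι → A) → ℝ} (s : Finset κ)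
    (hg : ∀ j, DependsOn (g j) (S j)) :
    DependsOn (fun D => ∏ j ∈ s, g j D) {i | ∃ j ∈ s, i ∈ S j} := fun _ _ h =>
  Finset.prod_congr rfl fun j hj => hg j fun i hi => h i ⟨j, hj, hi⟩

/-! ### Independence and Markov's inequality under product measures -/

section ProductMeasure

variable {ι A : Type*} [Fintype ι] [Finite A] [MeasurableSpace A] [MeasurableSingletonClass A]
  (ν : ι → Measure A) [∀ i, IsProbabilityMeasure (ν i)]

lemma indepFun_pi_of_dependsOn {β γ : Type*} [Nonempty β] [Nonempty γ] [MeasurableSpace β]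
    [MeasurableSpace γ] {S T : Set ι} (hST : Disjoint S T) {F : (ι → A) → β} {G : (ι → A) → γ}
    (hF : DependsOn F S) (hG : DependsOn G T) : IndepFun F G (Measure.pi ν) := by
  classical
  have hind : iIndepFun (fun i (ω : ι → A) => ω i) (Measure.pi ν) :=
    iIndepFun_pi (X := fun _ a => a) fun i => aemeasurable_id
  obtain ⟨f, rfl⟩ := dependsOn_iff_exists_comp.1 hF
  obtain ⟨g, rfl⟩ := dependsOn_iff_exists_comp.1 hG
  have hdis : Disjoint S.toFinset T.toFinset := by simpa using hST
  have h := hind.indepFun_finset S.toFinset T.toFinset hdis (fun i => measurable_pi_apply i)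
  exact h.comp (φ := fun a => f fun i => a ⟨i.1, by simp⟩)
    (ψ := fun a => g fun i => a ⟨i.1, by simp⟩) (Measurable.of_discrete) (Measurable.of_discrete)

lemma integral_pi_prod_of_dependsOn {κ : Type*} (c : ι → κ) {g : κ → (ι → A) → ℝ}
    (hg : ∀ j, DependsOn (g j) {i | c i = j}) (s : Finset κ) :
    ∫ D, ∏ j ∈ s, g j D ∂Measure.pi ν = ∏ j ∈ s, ∫ D, g j D ∂Measure.pi ν := by
  classical
  induction s using Finset.induction_on with
  | empty => simp
  | insert j s hj ih =>
    simp only [Finset.prod_insert hj]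
    rw [← ih]
    refine (indepFun_pi_of_dependsOn ν (Set.disjoint_left.2 ?_) (hg j)
      (dependsOn_prod s hg)).integral_fun_mul_eq_mul_integral
        (Measurable.of_discrete).aestronglyMeasurable (Measurable.of_discrete).aestronglyMeasurable
    rintro i hi ⟨j', hj', hi'⟩
    simp only [Set.mem_ofPred_eq] at hi hi'
    exact hj (by rwa [← hi, hi'])

lemma pi_real_forall_mem {κ : Type*} [Fintype κ] {e : κ → ι} (he : e.Injective)
    (B : κ → Set A) :
    (Measure.pi ν).real {D | ∀ k, D (e k) ∈ B k} = ∏ k, (ν (e k)).real (B k) := by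
  have hind : iIndepFun (fun i (ω : ι → A) => ω i) (Measure.pi ν) :=
    iIndepFun_pi (X := fun _ a => a) fun i => aemeasurable_id
  have h := (hind.precomp he).measure_inter_preimage_eq_mul Finset.univ (sets := B)
    fun i _ => MeasurableSet.of_discrete
  have h2 : {D : ι → A | ∀ k, D (e k) ∈ B k} =
      ⋂ k ∈ Finset.univ, (fun ω : ι → A => ω (e k)) ⁻¹' B k := by ext; simp
  rw [measureReal_def, h2, h, ENNReal.toReal_prod]
  refine Finset.prod_congr rfl fun k _ => ?_
  rw [measureReal_def]
  congr 1
  exact (measurePreserving_eval ν (e k)).measure_preimage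
    (MeasurableSet.of_discrete).nullMeasurableSet

lemma pi_real_eval_inter [Nonempty A] {i : ι} {G : Set (ι → A)} (hG : DependsOn (fun D => D ∈ G) {i}ᶜ)
    (B : Set A) :
    (Measure.pi ν).real ({D | D i ∈ B} ∩ G) = (ν i).real B * (Measure.pi ν).real G := by
  classical
  have hI : IndepFun (fun D : ι → A => D i) (fun D => D ∈ G) (Measure.pi ν) :=
    indepFun_pi_of_dependsOn ν (S := {i}) (T := {i}ᶜ) disjoint_compl_right
      (fun x y h => h i rfl) hG
  have h := hI.measure_inter_preimage_eq_mul B {True} MeasurableSet.of_discrete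
    MeasurableSet.of_discrete
  have h1 : (fun D => D ∈ G) ⁻¹' {True} = G := by ext; simp
  rw [h1, (measurePreserving_eval ν i).measure_preimage
    (MeasurableSet.of_discrete).nullMeasurableSet] at h
  have := congrArg ENNReal.toReal h
  rwa [ENNReal.toReal_mul] at this

/-- Markov's inequality for an event that forces a product of column functions to be large. -/
lemma pi_real_le_of_prod {κ : Type*} [Fintype κ] (c : ι → κ) {g : κ → (ι → A) → ℝ}
    (hg : ∀ j, DependsOn (g j) {i | c i = j}) (hg0 : ∀ j D, 0 ≤ g j D) {b t : ℝ} (ht : 0 < t)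
    (hgb : ∀ j, ∫ D, g j D ∂Measure.pi ν ≤ b) {E : Set (ι → A)}
    (hE : ∀ D ∈ E, t ≤ ∏ j, g j D) :
    (Measure.pi ν).real E ≤ b ^ Fintype.card κ / t := by
  have h1 : (Measure.pi ν).real E = ∫ D, E.indicator 1 D ∂Measure.pi ν :=
    (integral_indicator_one MeasurableSet.of_discrete).symm
  have h2 : ∫ D, E.indicator 1 D ∂Measure.pi ν ≤ ∫ D, (∏ j, g j D) / t ∂Measure.pi ν := by
    refine integral_mono .of_finite .of_finite fun D => ?_
    by_cases hD : D ∈ E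
    · simpa [hD, le_div_iff₀ ht] using hE D hD
    · simpa [hD] using div_nonneg (Finset.prod_nonneg fun j _ => hg0 j D) ht.le
  rw [h1]
  refine h2.trans ?_
  rw [integral_div, integral_pi_prod_of_dependsOn ν c hg]
  gcongr
  calc _ ≤ ∏ _j : κ, b := Finset.prod_le_prod
          (fun j _ => integral_nonneg (hg0 j)) fun j _ => hgb j
    _ = _ := by simp

end ProductMeasure

/-! ### Input distribution and channel output -/

lemma one_sub_sum_le_prod {κ : Type*} (s : Finset κ) (p : κ → ℝ) (h0 : ∀ k, 0 ≤ p k)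
    (h1 : ∀ k, p k ≤ 1) : 1 - ∑ k ∈ s, p k ≤ ∏ k ∈ s, (1 - p k) := by
  classical
  induction s using Finset.induction_on with
  | empty => simp
  | insert k s hk ih =>
    rw [Finset.sum_insert hk, Finset.prod_insert hk]
    have h2 : ∏ k ∈ s, (1 - p k) ≤ 1 :=
      Finset.prod_le_one (fun k _ => by linarith [h1 k]) fun k _ => by linarith [h0 k]
    nlinarith [h0 k, h1 k]

lemma activeProb_nonneg (n : ℕ) (r : ℝ) : 0 ≤ activeProb n r :=
  le_min zero_le_one (Real.sqrt_nonneg _)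

lemma activeProb_le_one (n : ℕ) (r : ℝ) : activeProb n r ≤ 1 := min_le_left _ _

lemma inputDist_real_singleton_zero (n : ℕ) (r : ℝ) :
    (inputDist n r).toMeasure.real {0} = 1 - activeProb n r := by
  rw [measureReal_def, PMF.toMeasure_apply_singleton _ _ (MeasurableSet.of_discrete)]
  simp [inputDist, activeProb_le_one]

lemma inputDist_real_singleton {n : ℕ} (r : ℝ) {a : InSymbol n} (ha : a ≠ 0) :
    (inputDist n r).toMeasure.real {a} = activeProb n r / 2 ^ n := by
  rw [measureReal_def, PMF.toMeasure_apply_singleton _ _ (MeasurableSet.of_discrete)]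
  have := activeProb_nonneg n r
  simp only [inputDist, PMF.ofFintype_apply, if_neg ha]
  rw [ENNReal.toReal_ofReal (by positivity)]
  ring

lemma inputDist_real_compl_zero (n : ℕ) (r : ℝ) :
    (inputDist n r).toMeasure.real {0}ᶜ = activeProb n r := by
  rw [probReal_compl_eq_one_sub MeasurableSet.of_discrete, inputDist_real_singleton_zero]
  ring

/-- User `k` alone sends a nonzero symbol. -/
def IsSingle {K n : ℕ} (k : Fin K) (x : Fin K → InSymbol n) : Prop :=
  x k ≠ 0 ∧ ∀ l, l ≠ k → x l = 0

lemma IsSingle.unique {K n : ℕ} {k l : Fin K} {x : Fin K → InSymbol n} (hk : IsSingle k x)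
    (hl : IsSingle l x) : k = l := by
  by_contra h
  exact hk.1 (hl.2 k h)

lemma IsSingle.collisionOutput_eq {K n : ℕ} {k : Fin K} {x : Fin K → InSymbol n}
    (h : IsSingle k x) : collisionOutput x = some (x k) := by
  have hex : ∃ k, x k ≠ 0 ∧ ∀ l, l ≠ k → x l = 0 := ⟨k, h⟩
  rw [collisionOutput, if_neg (fun h0 => h.1 (h0 k)), dif_pos hex]
  rw [IsSingle.unique (k := hex.choose) hex.choose_spec h]

lemma collisionOutput_eq_some_zero {K n : ℕ} {x : Fin K → InSymbol n} :
    collisionOutput x = some 0 ↔ ∀ k, x k = 0 := by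
  constructor
  · intro h
    by_contra h0
    rw [collisionOutput, if_neg h0] at h
    split_ifs at h with hex
    exact hex.choose_spec.1 (Option.some.inj h)
  · intro h
    rw [collisionOutput, if_pos h]

/-! ### The random symbol table and the events in a single position -/

/-- The symbols of all codewords of all users. -/
abbrev SymbolTable (K n : ℕ) (Rmax : ℝ) (N : ℕ) : Type :=
  Fin K × Message Rmax N × Fin N → InSymbol n

/-- The law of the symbols of all codewords. -/
noncomputable def tableMeasure (K n : ℕ) (Rmax : ℝ) (N : ℕ) : Measure (SymbolTable K n Rmax N) :=
  Measure.pi fun i => (inputDist n (stdRate i.2.1)).toMeasure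

instance (K n : ℕ) (Rmax : ℝ) (N : ℕ) : IsProbabilityMeasure (tableMeasure K n Rmax N) := by
  unfold tableMeasure; infer_instance

/-- The probability of a nonzero symbol in the codeword of the message `w`. -/
noncomputable abbrev messageProb (n : ℕ) {Rmax : ℝ} {N : ℕ} (w : Message Rmax N) : ℝ :=
  activeProb n (stdRate w)

variable {K n N : ℕ} {Rmax : ℝ}

/-- The input symbols at position `j` when the message vector `W` is sent. -/
def column (D : SymbolTable K n Rmax N) (W : Fin K → Message Rmax N) (j : Fin N) :
    Fin K → InSymbol n := fun k => D (k, W k, j)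

lemma column_congr {D D' : SymbolTable K n Rmax N} {j : Fin N}
    (h : ∀ i ∈ {i : Fin K × Message Rmax N × Fin N | i.2.2 = j}, D i = D' i)
    (W : Fin K → Message Rmax N) : column D W j = column D' W j :=
  funext fun _ => h _ rfl

lemma dependsOn_column_pair {β : Type*} (W W' : Fin K → Message Rmax N)
    (F : (Fin K → InSymbol n) → (Fin K → InSymbol n) → β) (j : Fin N) :
    DependsOn (fun D : SymbolTable K n Rmax N => F (column D W j) (column D W' j))
      {i | i.2.2 = j} := by
  intro D D' h
  simp only [column_congr h]

lemma tableMeasure_real_column (W : Fin K → Message Rmax N) (j : Fin N)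
    (B : Fin K → Set (InSymbol n)) :
    (tableMeasure K n Rmax N).real {D | ∀ k, column D W j k ∈ B k} =
      ∏ k, (inputDist n (stdRate (W k))).toMeasure.real (B k) :=
  pi_real_forall_mem (e := fun k => (k, W k, j)) _ (fun _ _ h => congrArg Prod.fst h) B

lemma tableMeasure_real_idle (W : Fin K → Message Rmax N) (j : Fin N) (s : Finset (Fin K)) :
    (tableMeasure K n Rmax N).real {D | ∀ l ∈ s, column D W j l = 0} =
      ∏ l ∈ s, (1 - messageProb n (W l)) := by
  classical
  have h := tableMeasure_real_column (n := n) W j (fun l => if l ∈ s then {0} else Set.univ)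
  rw [show {D : SymbolTable K n Rmax N | ∀ l ∈ s, column D W j l = 0} =
    {D | ∀ k, column D W j k ∈ if k ∈ s then ({0} : Set (InSymbol n)) else Set.univ} by
      ext D; refine forall_congr' fun k => ?_; by_cases hk : k ∈ s <;> simp [hk], h,
    ← Finset.prod_subset (Finset.subset_univ s)]
  · exact Finset.prod_congr rfl fun l hl => by simp [hl, inputDist_real_singleton_zero]
  · intro l _ hl
    simp [hl]

/-- The side condition ensures that the active symbol of user `k` is not among the symbols required
to be idle, so the two events are independent. -/
lemma tableMeasure_real_active_idle (W W' : Fin K → Message Rmax N) (j : Fin N)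
    {s : Finset (Fin K)} {k : Fin K} (hk : k ∈ s → W' k ≠ W k) :
    (tableMeasure K n Rmax N).real {D | column D W j k ≠ 0 ∧ ∀ l ∈ s, column D W' j l = 0} =
      messageProb n (W k) * ∏ l ∈ s, (1 - messageProb n (W' l)) := by
  rw [← tableMeasure_real_idle W' j, messageProb, ← inputDist_real_compl_zero]
  refine pi_real_eval_inter (fun i : Fin K × Message Rmax N × Fin N =>
    (inputDist n (stdRate i.2.1)).toMeasure) (i := (k, W k, j))
    (G := {D | ∀ l ∈ s, column D W' j l = 0}) ?_ {0}ᶜ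
  intro D D' h
  simp only [Set.mem_ofPred_eq, eq_iff_iff]
  refine forall₂_congr fun l hl => ?_
  rw [column, column, h]
  simp only [Set.mem_compl_iff, Set.mem_singleton_iff, Prod.mk.injEq, not_and]
  rintro rfl h
  exact (hk hl h).elim

lemma tableMeasure_real_isSingle (W : Fin K → Message Rmax N) (j : Fin N) (k : Fin K) :
    (tableMeasure K n Rmax N).real {D | IsSingle k (column D W j)} =
      messageProb n (W k) * ∏ l ∈ Finset.univ.erase k, (1 - messageProb n (W l)) := by
  rw [← tableMeasure_real_active_idle W W j (by simp)]
  simp [IsSingle]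

/-- The symbol that user `k` alone sends with a wrong message matches the channel output with
probability `1 / 2 ^ n`. -/
lemma tableMeasure_real_isSingle_match_le (W W' : Fin K → Message Rmax N) (j : Fin N) {k : Fin K}
    (hk : W' k ≠ W k) :
    2 ^ n * (tableMeasure K n Rmax N).real {D | IsSingle k (column D W' j) ∧
        collisionOutput (column D W j) = collisionOutput (column D W' j)} ≤
      (tableMeasure K n Rmax N).real {D | IsSingle k (column D W' j)} := by
  classical
  set μ := tableMeasure K n Rmax N
  set s := Finset.univ.erase k
  let G : InSymbol n → Set (SymbolTable K n Rmax N) := fun a =>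
    {D | (∀ l ∈ s, column D W' j l = 0) ∧ collisionOutput (column D W j) = some a}
  -- As the two messages of user `k` differ, the output for `W` does not involve the symbol at `(k,
  -- W' k, j)`. That symbol is thus independent of `G a` and takes each nonzero value with the same
  -- probability.
  have hG : ∀ a, DependsOn (fun D => D ∈ G a) {(k, W' k, j)}ᶜ := by
    intro a D D' h
    have h1 : column D W j = column D' W j := funext fun l => h _ (by
      simp only [Set.mem_compl_iff, Set.mem_singleton_iff, Prod.mk.injEq, not_and]
      rintro rfl h
      exact (hk h.symm).elim)
    simp only [G, Set.mem_ofPred_eq, eq_iff_iff, h1]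
    refine and_congr_left fun _ => forall₂_congr fun l hl => ?_
    rw [column, column, h]
    rintro ⟨⟩
    simp [s] at hl
  have hcover : {D : SymbolTable K n Rmax N | IsSingle k (column D W' j) ∧
        collisionOutput (column D W j) = collisionOutput (column D W' j)} ⊆
      ⋃ a ∈ Finset.univ.erase (0 : InSymbol n), {D | D (k, W' k, j) ∈ ({a} : Set _)} ∩ G a := by
    rintro D ⟨h1, h2⟩
    rw [h1.collisionOutput_eq] at h2
    simp only [Set.mem_iUnion]
    exact ⟨column D W' j k, by simp [h1.1], rfl, fun l hl => h1.2 l (by simpa [s] using hl), h2⟩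
  have hdis : ∑ a ∈ Finset.univ.erase (0 : InSymbol n), μ.real (G a) ≤
      μ.real {D | ∀ l ∈ s, column D W' j l = 0} := by
    rw [← measureReal_biUnion_finset]
    · refine measureReal_mono ?_
      simp only [Set.iUnion_subset_iff]
      exact fun a _ D hD => hD.1
    · intro a _ b _ hab
      refine Set.disjoint_left.2 fun D hD hD' => hab ?_
      exact Option.some.inj (hD.2.symm.trans hD'.2)
    · exact fun a _ => MeasurableSet.of_discrete
  have hp := activeProb_nonneg n (stdRate (W' k))
  calc 2 ^ n * μ.real _ ≤ 2 ^ n * ∑ a ∈ Finset.univ.erase (0 : InSymbol n),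
        μ.real ({D | D (k, W' k, j) ∈ ({a} : Set _)} ∩ G a) := by
        gcongr
        exact (measureReal_mono hcover (measure_ne_top (tableMeasure K n Rmax N) _)).trans (measureReal_biUnion_finset_le _ _)
    _ = 2 ^ n * ∑ a ∈ Finset.univ.erase (0 : InSymbol n),
        messageProb n (W' k) / 2 ^ n * μ.real (G a) := by
        congr 1
        refine Finset.sum_congr rfl fun a ha => ?_
        rw [← inputDist_real_singleton _ (Finset.ne_of_mem_erase ha)]
        exact pi_real_eval_inter _ (hG a) _
    _ = messageProb n (W' k) * ∑ a ∈ Finset.univ.erase (0 : InSymbol n), μ.real (G a) := by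
        rw [← Finset.mul_sum]
        field_simp
    _ ≤ messageProb n (W' k) * μ.real {D | ∀ l ∈ s, column D W' j l = 0} := by gcongr
    _ = _ := by rw [tableMeasure_real_isSingle, tableMeasure_real_idle]

/-! ### Acceptance test and concentration for the sent vector -/

open Classical in
/-- The number of positions in which user `k` alone sends a nonzero symbol. -/
noncomputable def singleCount (D : SymbolTable K n Rmax N) (W : Fin K → Message Rmax N)
    (k : Fin K) : ℕ := Finset.card {j | IsSingle k (column D W j)}

/-- The output sequence of the channel when the message vector `W` is sent. -/
noncomputable def channelOutput (D : SymbolTable K n Rmax N) (W : Fin K → Message Rmax N) :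
    Fin N → OutSymbol n := fun j => collisionOutput (column D W j)

/-- The message vector `W` satisfies the acceptance conditions of the decoder with margin `ε`
when the output sequence is `y`. -/
structure Accepts (ε : ℝ) (D : SymbolTable K n Rmax N) (y : Fin N → OutSymbol n)
    (W : Fin K → Message Rmax N) : Prop where
  sum_le : ∑ k, messageProb n (W k) ≤ 1 - ε
  consistent : ∀ j, y j = collisionOutput (column D W j)
  le_singleCount : ∀ k, N * (messageProb n (W k) * (messageProb n (W k) + ε / 2)) ≤
    singleCount D W k

/-- The other users are all idle with probability at least `1 - ∑_{l ≠ k} p_l`, which the sum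
constraint bounds below by `p_k + ε`. Half of this surplus `ε` is given up in the acceptance
threshold. -/
lemma mul_add_le_prob_isSingle {ε : ℝ} (W : Fin K → Message Rmax N)
    (hW : ∑ k, messageProb n (W k) ≤ 1 - ε) (j : Fin N) (k : Fin K) :
    messageProb n (W k) * (messageProb n (W k) + ε) ≤
      (tableMeasure K n Rmax N).real {D | IsSingle k (column D W j)} := by
  rw [tableMeasure_real_isSingle]
  refine mul_le_mul_of_nonneg_left ?_ (activeProb_nonneg _ _)
  refine le_trans ?_ (one_sub_sum_le_prod _ _ (fun l => activeProb_nonneg n _)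
    fun l => activeProb_le_one n _)
  rw [← Finset.add_sum_erase _ _ (Finset.mem_univ k)] at hW
  linarith

lemma sub_sq_le_one_sub_exp_neg {x : ℝ} (hx : 0 ≤ x) : x - x ^ 2 ≤ 1 - Real.exp (-x) := by
  have h1 := Real.add_one_le_exp x
  have h2 : Real.exp (-x) ≤ (x + 1)⁻¹ := by
    rw [Real.exp_neg]
    exact inv_anti₀ (by linarith) h1
  have h3 : (x + 1)⁻¹ ≤ 1 - x + x ^ 2 := by
    rw [inv_le_iff_one_le_mul₀ (by linarith)]
    nlinarith [pow_nonneg hx 3]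
  linarith

lemma integral_one_sub_mul_indicator {Ω : Type*} [Finite Ω] [MeasurableSpace Ω]
    [MeasurableSingletonClass Ω] (μ : Measure Ω) [IsProbabilityMeasure μ] (E : Set Ω) (c : ℝ) :
    ∫ D, (1 - c * E.indicator 1 D) ∂μ = 1 - c * μ.real E := by
  rw [integral_sub .of_finite .of_finite, integral_const_mul,
    integral_indicator_one MeasurableSet.of_discrete]
  simp

/-- Chernoff bound for the number of positions in which user `k` alone sends a nonzero symbol. -/
lemma tableMeasure_real_singleCount_lt_le {ε : ℝ} (hε : 0 ≤ ε) (W : Fin K → Message Rmax N)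
    (hW : ∑ k, messageProb n (W k) ≤ 1 - ε) (k : Fin K) :
    (tableMeasure K n Rmax N).real {D | (singleCount D W k : ℝ) <
        N * (messageProb n (W k) * (messageProb n (W k) + ε / 2))} ≤
      Real.exp (-(N * messageProb n (W k) * ε ^ 2 / 16)) := by
  classical
  set p := messageProb n (W k) with hp
  have hp0 : 0 ≤ p := activeProb_nonneg _ _
  have hpε : p + ε ≤ 1 := by
    have := Finset.single_le_sum (f := fun k => messageProb n (W k))
      (fun k _ => activeProb_nonneg n _) (Finset.mem_univ k)
    simp only [← hp] at this
    linarith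
  -- Per position the exponent is at most `p (x^2 (p + ε) - x ε / 2)`. With `p + ε ≤ 1`, the choice
  -- `x = ε / 4` minimizes the resulting bound `p (x^2 - x ε / 2)`, at `-p ε^2 / 16`.
  set x := ε / 4 with hx
  have hx0 : 0 ≤ x := by positivity
  have key := pi_real_le_of_prod (fun i : Fin K × Message Rmax N × Fin N =>
    (inputDist n (stdRate i.2.1)).toMeasure) (fun i => i.2.2)
    (g := fun j D => if IsSingle k (column D W j) then Real.exp (-x) else 1)
    (fun j => dependsOn_column_pair W W (fun y _ => if IsSingle k y then Real.exp (-x) else 1) j)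
    (fun j D => by split_ifs <;> positivity)
    (b := Real.exp (-((x - x ^ 2) * (p * (p + ε)))))
    (t := Real.exp (-(x * (N * (p * (p + ε / 2)))))) (Real.exp_pos _) ?_
    (E := {D | (singleCount D W k : ℝ) < N * (p * (p + ε / 2))}) ?_
  · refine key.trans ?_
    rw [Fintype.card_fin, ← Real.exp_nat_mul, ← Real.exp_sub, Real.exp_le_exp]
    have h1 : p * ((p + ε) * ε ^ 2) ≤ p * (1 * ε ^ 2) := by gcongr
    have h2 : (N : ℝ) * (p * ((p + ε) * ε ^ 2)) ≤ N * (p * (1 * ε ^ 2)) := by gcongr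
    rw [hx]
    nlinarith
  · intro j
    have h := integral_one_sub_mul_indicator (tableMeasure K n Rmax N)
      {D | IsSingle k (column D W j)} (1 - Real.exp (-x))
    have h1 : ∀ D : SymbolTable K n Rmax N,
        (if IsSingle k (column D W j) then Real.exp (-x) else 1) =
        1 - (1 - Real.exp (-x)) * Set.indicator {D | IsSingle k (column D W j)} 1 D := by
      intro D
      by_cases hD : IsSingle k (column D W j) <;> simp [hD]
    simp only [h1]
    refine h.le.trans (le_trans ?_ (Real.one_sub_le_exp_neg _))
    have h2 := mul_add_le_prob_isSingle W hW j k
    have h3 := sub_sq_le_one_sub_exp_neg hx0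
    have h4 : 0 ≤ x - x ^ 2 := by nlinarith
    have := mul_le_mul h3 h2 (by positivity) (h4.trans h3)
    simp only [← hp] at this
    linarith
  · intro D hD
    have h : ∏ j, (if IsSingle k (column D W j) then Real.exp (-x) else 1) =
        Real.exp (-x) ^ singleCount D W k := by
      simp [Finset.prod_ite, singleCount]
    simp only [h]
    rw [← Real.exp_nat_mul, Real.exp_le_exp]
    have : (singleCount D W k : ℝ) < N * (p * (p + ε / 2)) := hD
    nlinarith

/-! ### Acceptance of a wrong vector -/

/-- Weight a matching position by `2^n` if some user of `s` is alone in it under `W'`, by `1`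
otherwise, and a mismatch by `0`. The mean weight is at most `1`, since the match has conditional
probability at most `2^(-n)`. On acceptance the product of the weights is `2^n` to the number of
such positions, so Markov's inequality applies. -/
lemma tableMeasure_real_accepts_le (ε : ℝ) (W W' : Fin K → Message Rmax N) (s : Finset (Fin K))
    (hs : ∀ k ∈ s, W' k ≠ W k) :
    (tableMeasure K n Rmax N).real {D | Accepts ε D (channelOutput D W) W'} ≤
      ((2 : ℝ) ^ (n * (N * ∑ k ∈ s, messageProb n (W' k) * (messageProb n (W' k) + ε / 2))))⁻¹ := by
  classical
  -- At most one user is alone, so at most one factor differs from `1`, and the product becomes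
  -- linear in the indicators.
  have hprod : ∀ (f : (Fin K → InSymbol n)),
      ∏ k ∈ s, (if IsSingle k f then (2 : ℝ) ^ n else 1) =
        1 + ∑ k ∈ s, (if IsSingle k f then (2 : ℝ) ^ n - 1 else 0) := by
    intro f
    by_cases h : ∃ k ∈ s, IsSingle k f
    · obtain ⟨k, hk, hf⟩ := h
      have h1 : ∀ l, IsSingle l f ↔ l = k := fun l =>
        ⟨fun h => h.unique hf, fun h => h ▸ hf⟩
      simp [h1, hk]
    · push Not at h
      rw [Finset.prod_congr rfl fun k hk => if_neg (h k hk),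
        Finset.sum_congr rfl fun k hk => if_neg (h k hk)]
      simp
  have key := pi_real_le_of_prod (fun i : Fin K × Message Rmax N × Fin N =>
    (inputDist n (stdRate i.2.1)).toMeasure) (fun i => i.2.2)
    (g := fun j D => if collisionOutput (column D W j) = collisionOutput (column D W' j) then
      ∏ k ∈ s, (if IsSingle k (column D W' j) then (2 : ℝ) ^ n else 1) else 0)
    (fun j => dependsOn_column_pair W W' (fun y y' => if collisionOutput y = collisionOutput y' then
      ∏ k ∈ s, (if IsSingle k y' then (2 : ℝ) ^ n else 1) else 0) j)
    (fun j D => by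
      split_ifs
      · exact Finset.prod_nonneg fun k _ => by split_ifs <;> positivity
      · exact le_rfl)
    (b := 1)
    (t := (2 : ℝ) ^ (n * (N * ∑ k ∈ s, messageProb n (W' k) * (messageProb n (W' k) + ε / 2))))
    (by positivity) ?_ (E := {D | Accepts ε D (channelOutput D W) W'}) ?_
  · refine key.trans (by simp)
  · intro j
    let E : Fin K → Set (SymbolTable K n Rmax N) := fun k => {D | IsSingle k (column D W' j)}
    let F : Fin K → Set (SymbolTable K n Rmax N) := fun k => {D | IsSingle k (column D W' j) ∧
      collisionOutput (column D W j) = collisionOutput (column D W' j)}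
    -- On a mismatch the left side is `0` and the right side is `1` minus the number of users of `s`
    -- that are alone, which is at most one.
    calc _ ≤ ∫ D, (1 + ∑ k ∈ s, ((2 : ℝ) ^ n * (F k).indicator 1 D - (E k).indicator 1 D))
          ∂tableMeasure K n Rmax N := by
          refine integral_mono .of_finite .of_finite fun D => ?_
          simp only
          split_ifs with h
          · rw [hprod]
            refine add_le_add le_rfl (Finset.sum_le_sum fun k _ => ?_)
            by_cases hk : IsSingle k (column D W' j) <;> simp [E, F, hk, h]
          · have h1 : ∀ k, (F k).indicator (1 : SymbolTable K n Rmax N → ℝ) D = 0 := fun k => by simp [F, h]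
            simp only [h1, mul_zero, zero_sub, Finset.sum_neg_distrib]
            by_cases h2 : ∃ k, IsSingle k (column D W' j)
            · obtain ⟨k, hk⟩ := h2
              have h3 : ∀ l, IsSingle l (column D W' j) ↔ l = k := fun l =>
                ⟨fun h => h.unique hk, fun h => h ▸ hk⟩
              simp only [E, Set.indicator_apply, Set.mem_ofPred_eq, h3]
              by_cases hks : k ∈ s <;> simp [hks]
            · push Not at h2
              simp [E, h2]
      _ = 1 + ∑ k ∈ s, ((2 : ℝ) ^ n * (tableMeasure K n Rmax N).real (F k) -
            (tableMeasure K n Rmax N).real (E k)) := by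
          rw [integral_add .of_finite .of_finite, integral_finsetSum _ fun _ _ => .of_finite]
          congr 1
          · simp
          · refine Finset.sum_congr rfl fun k _ => ?_
            rw [integral_sub .of_finite .of_finite, integral_const_mul,
              integral_indicator_one MeasurableSet.of_discrete,
              integral_indicator_one MeasurableSet.of_discrete]
      _ ≤ 1 := by
          have : ∑ k ∈ s, ((2 : ℝ) ^ n * (tableMeasure K n Rmax N).real (F k) -
            (tableMeasure K n Rmax N).real (E k)) ≤ 0 := Finset.sum_nonpos fun k hk =>
              sub_nonpos.2 (tableMeasure_real_isSingle_match_le W W' j (hs k hk))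
          linarith
  · intro D hD
    have h : ∏ j, (if collisionOutput (column D W j) = collisionOutput (column D W' j) then
        ∏ k ∈ s, (if IsSingle k (column D W' j) then (2 : ℝ) ^ n else 1) else 0) =
        (2 : ℝ) ^ (n * ∑ k ∈ s, singleCount D W' k) := by
      have hc : ∀ j, collisionOutput (column D W j) = collisionOutput (column D W' j) :=
        hD.consistent
      simp only [hc, if_true]
      rw [Finset.prod_comm, pow_mul, ← Finset.prod_pow_eq_pow_sum]
      refine Finset.prod_congr rfl fun k _ => ?_
      simp [Finset.prod_ite, singleCount]
    simp only [h]
    rw [← Real.rpow_natCast]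
    refine Real.rpow_le_rpow_of_exponent_le one_le_two ?_
    push_cast
    rw [Finset.mul_sum]
    gcongr with k hk
    exact hD.le_singleCount k

/-- A position with user `k` active under `W` and everyone idle under `W'` rules out consistency,
since only an all-idle input yields the output `0`. Such a position occurs with probability at least
`p_k ε`, independently over positions. This bound does not rely on the counts, which are void when
`W'` has zero activity. -/
lemma tableMeasure_real_accepts_le_exp {ε : ℝ} (W W' : Fin K → Message Rmax N) {k : Fin K}
    (hk : W' k ≠ W k) :
    (tableMeasure K n Rmax N).real {D | Accepts ε D (channelOutput D W) W'} ≤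
      Real.exp (-(N * (messageProb n (W k) * ε))) := by
  classical
  by_cases hsum : ∑ k, messageProb n (W' k) ≤ 1 - ε
  swap
  · rw [show {D : SymbolTable K n Rmax N | Accepts ε D (channelOutput D W) W'} = ∅ from
      Set.eq_empty_of_forall_notMem fun D hD => hsum hD.sum_le]
    simpa using (Real.exp_pos _).le
  let E : Fin N → Set (SymbolTable K n Rmax N) := fun j =>
    {D | column D W j k ≠ 0 ∧ ∀ l ∈ Finset.univ, column D W' j l = 0}
  have key := pi_real_le_of_prod (fun i : Fin K × Message Rmax N × Fin N =>
    (inputDist n (stdRate i.2.1)).toMeasure) (fun i => i.2.2)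
    (g := fun j D => 1 - 1 * (E j).indicator 1 D)
    (fun j D D' h => by
      simp only [E, Set.indicator_apply, Set.mem_ofPred_eq, column_congr h, Pi.one_apply])
    (fun j D => by by_cases h : D ∈ E j <;> simp [h])
    (b := Real.exp (-(messageProb n (W k) * ε))) (t := 1) one_pos ?_
    (E := {D | Accepts ε D (channelOutput D W) W'}) ?_
  · refine key.trans ?_
    rw [Fintype.card_fin, ← Real.exp_nat_mul, div_one, mul_neg]
  · intro j
    refine (integral_one_sub_mul_indicator (tableMeasure K n Rmax N) (E j) 1).le.trans
      (le_trans ?_ (Real.one_sub_le_exp_neg _))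
    rw [one_mul, tableMeasure_real_active_idle W W' j (fun _ => hk)]
    have h1 := one_sub_sum_le_prod Finset.univ (fun l => messageProb n (W' l))
      (fun l => activeProb_nonneg n _) fun l => activeProb_le_one n _
    have h2 := mul_le_mul_of_nonneg_left (show ε ≤ ∏ l, (1 - messageProb n (W' l)) by linarith)
      (activeProb_nonneg n (stdRate (W k)))
    linarith
  · intro D hD
    refine (Finset.prod_eq_one fun j _ => ?_).ge
    have : D ∉ E j := by
      rintro ⟨h1, h2⟩
      have h3 : collisionOutput (column D W j) = collisionOutput (column D W' j) :=
        hD.consistent j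
      rw [collisionOutput_eq_some_zero.2 (fun l => h2 l (Finset.mem_univ l)),
        collisionOutput_eq_some_zero] at h3
      exact h1 (h3 k)
    simp [this]

/-! ### Union bound over all wrong vectors -/

lemma stdRate_nonneg (w : Message Rmax N) : 0 ≤ stdRate w :=
  div_nonneg (Real.logb_nonneg one_lt_two (by simp)) (Nat.cast_nonneg _)

lemma sqrt_inv_le_messageProb (hn : 1 ≤ n) (hN : 1 ≤ N) (w : Message Rmax N) (hw : (w : ℕ) ≠ 0) :
    √(1 / (N * n)) ≤ messageProb n w := by
  have hn' : (1 : ℝ) ≤ n := by exact_mod_cast hn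
  have hN' : (1 : ℝ) ≤ N := by exact_mod_cast hN
  refine le_min ?_ (Real.sqrt_le_sqrt ?_)
  · refine Real.sqrt_le_iff.2 ⟨zero_le_one, ?_⟩
    rw [one_pow, div_le_one (by positivity)]
    nlinarith
  · rw [stdRate, div_div]
    gcongr
    rw [Real.le_logb_iff_rpow_le one_lt_two (by positivity), Real.rpow_one]
    have : (1 : ℝ) ≤ (w : ℕ) := by exact_mod_cast Nat.one_le_iff_ne_zero.2 hw
    linarith

/-- Here the choice `p = √(r/n)` enters: `n N p^2 = N r` is the logarithm of the message number. The
hypothesis excludes the truncation at `1`. -/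
lemma two_rpow_mul_messageProb_sq (hn : 1 ≤ n) (hN : 1 ≤ N) (w : Message Rmax N)
    (hw : messageProb n w < 1) :
    (2 : ℝ) ^ (n * (N * messageProb n w ^ 2)) = (w : ℕ) + 1 := by
  have hn' : (1 : ℝ) ≤ n := by exact_mod_cast hn
  have hN' : (1 : ℝ) ≤ N := by exact_mod_cast hN
  have h : messageProb n w = √(stdRate w / n) := by
    rcases min_choice (1 : ℝ) √(stdRate w / n) with h | h
    · exact absurd h hw.ne
    · exact h
  rw [h, Real.sq_sqrt (div_nonneg (stdRate_nonneg w) (by positivity)), stdRate,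
    show (n : ℝ) * (N * (Real.logb 2 ((w : ℕ) + 1) / N / n)) = Real.logb 2 ((w : ℕ) + 1) by
      field_simp, Real.rpow_logb two_pos (by norm_num) (by positivity)]

open Classical in
lemma tableMeasure_real_accepts_wrong_le (hn : 1 ≤ n) (hN : 1 ≤ N) {ε : ℝ} (hε : 0 < ε)
    {W W' : Fin K → Message Rmax N} (h : W' ≠ W) :
    (tableMeasure K n Rmax N).real {D | Accepts ε D (channelOutput D W) W'} ≤
      (∏ k, if W' k = W k then 1 else (((W' k : ℕ) : ℝ) + 1)⁻¹) *
        Real.exp (-(N * √(1 / (N * n)) * ε / 4)) := by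
  have hn' : (1 : ℝ) ≤ n := by exact_mod_cast hn
  have hN' : (1 : ℝ) ≤ N := by exact_mod_cast hN
  by_cases hsum : ∑ k, messageProb n (W' k) ≤ 1 - ε
  swap
  · rw [show {D : SymbolTable K n Rmax N | Accepts ε D (channelOutput D W) W'} = ∅ from
      Set.eq_empty_of_forall_notMem fun D hD => hsum hD.sum_le]
    simp only [measureReal_empty]
    refine mul_nonneg (Finset.prod_nonneg fun k _ => ?_) (Real.exp_pos _).le
    split_ifs <;> positivity
  have hp0 : ∀ k, 0 ≤ messageProb n (W' k) := fun k => activeProb_nonneg n _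
  have hp1 : ∀ k, messageProb n (W' k) < 1 := fun k => by
    have := Finset.single_le_sum (f := fun k => messageProb n (W' k)) (fun k _ => hp0 k)
      (Finset.mem_univ k)
    linarith
  set s : Finset (Fin K) := {k | W' k ≠ W k} with hs
  have hprod : (∏ k, if W' k = W k then 1 else (((W' k : ℕ) : ℝ) + 1)⁻¹) =
      (∏ k ∈ s, (((W' k : ℕ) : ℝ) + 1))⁻¹ := by
    rw [← Finset.prod_inv_distrib, hs, Finset.prod_filter]
    refine Finset.prod_congr rfl fun k _ => ?_
    by_cases h : W' k = W k <;> simp [h]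
  rw [hprod]
  -- The index `0` stands for the message `1`, of rate `0` and activity `0`. A wrong message other
  -- than it makes the linear part of the exponent at least of order `√N ε`.
  by_cases hfirst : ∃ k ∈ s, (W' k : ℕ) ≠ 0
  · obtain ⟨k, hks, hk⟩ := hfirst
    refine (tableMeasure_real_accepts_le ε W W' s fun k hk => by simpa [hs] using hk).trans ?_
    have h1 : (n : ℝ) * (N * ∑ k ∈ s, messageProb n (W' k) * (messageProb n (W' k) + ε / 2)) =
        ∑ k ∈ s, n * (N * messageProb n (W' k) ^ 2) +
          n * N * (ε / 2) * ∑ k ∈ s, messageProb n (W' k) := by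
      simp only [Finset.mul_sum]
      rw [← Finset.sum_add_distrib]
      exact Finset.sum_congr rfl fun k _ => by ring
    rw [h1, Real.rpow_add two_pos, Real.rpow_sum_of_pos two_pos,
      Finset.prod_congr rfl fun k _ => two_rpow_mul_messageProb_sq hn hN (W' k) (hp1 k), mul_inv,
      Real.exp_neg]
    gcongr
    have h2 : √(1 / (N * n)) ≤ ∑ k ∈ s, messageProb n (W' k) :=
      (sqrt_inv_le_messageProb hn hN _ hk).trans
        (Finset.single_le_sum (f := fun k => messageProb n (W' k)) (fun k _ => hp0 k) hks)
    rw [Real.rpow_def_of_pos two_pos, Real.exp_le_exp]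
    have h3 : (1 / 2 : ℝ) ≤ Real.log 2 := by linarith [Real.log_two_gt_d9]
    calc _ = 1 / 2 * (1 * N * (ε / 2) * √(1 / (N * n))) := by ring
      _ ≤ _ := by gcongr
  · push Not at hfirst
    obtain ⟨k, hk⟩ := Function.ne_iff.1 h
    rw [Finset.prod_eq_one fun k hk => by simp [hfirst k hk], inv_one, one_mul]
    refine (tableMeasure_real_accepts_le_exp W W' hk).trans (Real.exp_le_exp.2 ?_)
    -- The wrong message is the first one, so the true one is not and has positive activity.
    have h0 : (W k : ℕ) ≠ 0 := fun h0 =>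
      hk (Fin.ext ((hfirst k (by simpa [hs] using hk)).trans h0.symm))
    have h1 := sqrt_inv_le_messageProb hn hN (W k) h0
    have h2 : N * (√(1 / (N * n)) * ε) ≤ N * (messageProb n (W k) * ε) := by gcongr
    have h3 : 0 ≤ N * (√(1 / (N * n)) * ε) := by positivity
    linarith

lemma sum_inv_message_le (hRmax : 0 ≤ Rmax) :
    ∑ w : Message Rmax N, (((w : ℕ) : ℝ) + 1)⁻¹ ≤ 1 + N * Rmax := by
  have h1 : (1 : ℝ) ≤ (2 : ℝ) ^ ((N : ℝ) * Rmax) :=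
    Real.one_le_rpow one_le_two (by positivity)
  have h := harmonic_floor_le_one_add_log _ h1
  rw [Real.log_rpow two_pos] at h
  have h2 : ∑ w : Message Rmax N, (((w : ℕ) : ℝ) + 1)⁻¹ =
      (harmonic ⌊(2 : ℝ) ^ ((N : ℝ) * Rmax)⌋₊ : ℝ) := by
    rw [Fin.sum_univ_eq_sum_range (fun w => ((w : ℝ) + 1)⁻¹), harmonic]
    simp [numMessages]
  rw [h2]
  refine h.trans ?_
  have h3 : Real.log 2 ≤ 1 := by linarith [Real.log_two_lt_d9]
  have h4 : (N : ℝ) * Rmax * Real.log 2 ≤ N * Rmax * 1 := by gcongr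
  linarith

/-- Some wrong message vector is accepted with small probability, whatever `W` is sent. -/
lemma tableMeasure_real_exists_accepts_le (hn : 1 ≤ n) (hN : 1 ≤ N) (hRmax : 0 ≤ Rmax) {ε : ℝ}
    (hε : 0 < ε) (W : Fin K → Message Rmax N) :
    (tableMeasure K n Rmax N).real {D | ∃ W', W' ≠ W ∧ Accepts ε D (channelOutput D W) W'} ≤
      (2 + N * Rmax) ^ K * Real.exp (-(N * √(1 / (N * n)) * ε / 4)) := by
  classical
  have hcover : {D : SymbolTable K n Rmax N | ∃ W', W' ≠ W ∧ Accepts ε D (channelOutput D W) W'} ⊆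
      ⋃ W' ∈ Finset.univ.erase W, {D | Accepts ε D (channelOutput D W) W'} := by
    rintro D ⟨W', h, hD⟩
    simp only [Set.mem_iUnion]
    exact ⟨W', by simp [h], hD⟩
  let f : (k : Fin K) → Message Rmax N → ℝ := fun k w =>
    if w = W k then 1 else (((w : ℕ) : ℝ) + 1)⁻¹
  have hf0 : ∀ k w, 0 ≤ f k w := fun k w => by simp only [f]; split_ifs <;> positivity
  calc _ ≤ ∑ W' ∈ Finset.univ.erase W,
        (tableMeasure K n Rmax N).real {D | Accepts ε D (channelOutput D W) W'} :=
        (measureReal_mono hcover (measure_ne_top _ _)).trans (measureReal_biUnion_finset_le _ _)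
    _ ≤ ∑ W' ∈ Finset.univ.erase W,
        (∏ k, f k (W' k)) * Real.exp (-(N * √(1 / (N * n)) * ε / 4)) :=
        Finset.sum_le_sum fun W' hW' =>
          tableMeasure_real_accepts_wrong_le hn hN hε (Finset.ne_of_mem_erase hW')
    _ ≤ (∑ W' : Fin K → Message Rmax N, ∏ k, f k (W' k)) * Real.exp (-(N * √(1 / (N * n)) * ε / 4)) := by
        rw [← Finset.sum_mul]
        gcongr
        exact Finset.subset_univ _
    _ = (∏ k, ∑ w, f k w) * Real.exp (-(N * √(1 / (N * n)) * ε / 4)) := by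
        rw [Finset.prod_univ_sum, Fintype.piFinset_univ]
    _ ≤ _ := by
        gcongr
        calc _ ≤ ∏ _k : Fin K, (2 + N * Rmax) := by
              refine Finset.prod_le_prod (fun k _ => Finset.sum_nonneg fun w _ => hf0 k w)
                fun k _ => ?_
              -- The correct message contributes `1`, and the wrong ones at most a harmonic sum.
              calc ∑ w, f k w ≤ ∑ w : Message Rmax N,
                    ((if w = W k then 1 else 0) + (((w : ℕ) : ℝ) + 1)⁻¹) := by
                    refine Finset.sum_le_sum fun w _ => ?_
                    have : (0 : ℝ) ≤ (((w : ℕ) : ℝ) + 1)⁻¹ := by positivity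
                    simp only [f]
                    split_ifs <;> linarith
                _ ≤ _ := by
                    rw [Finset.sum_add_distrib]
                    have := sum_inv_message_le (N := N) hRmax
                    simp only [Finset.sum_ite_eq', Finset.mem_univ, if_true]
                    linarith
          _ = _ := by simp

/-- The sent message vector is accepted with high probability. -/
lemma tableMeasure_real_not_accepts_self_le (hn : 1 ≤ n) (hN : 1 ≤ N) {ε : ℝ} (hε : 0 ≤ ε)
    (W : Fin K → Message Rmax N) (hW : ∑ k, messageProb n (W k) ≤ 1 - ε) :
    (tableMeasure K n Rmax N).real {D | ¬ Accepts ε D (channelOutput D W) W} ≤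
      K * Real.exp (-(N * √(1 / (N * n)) * ε ^ 2 / 16)) := by
  classical
  let E : Fin K → Set (SymbolTable K n Rmax N) := fun k => {D | (singleCount D W k : ℝ) <
        N * (messageProb n (W k) * (messageProb n (W k) + ε / 2))}
  have hcover : {D : SymbolTable K n Rmax N | ¬ Accepts ε D (channelOutput D W) W} ⊆ ⋃ k ∈ Finset.univ, E k := by
    intro D hD
    by_contra h
    simp only [E, Set.mem_iUnion, Finset.mem_univ, Set.mem_ofPred_eq, exists_prop, true_and,
      not_exists, not_lt] at h
    exact hD ⟨hW, fun _ => rfl, h⟩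
  calc _ ≤ ∑ k, (tableMeasure K n Rmax N).real (E k) :=
        (measureReal_mono hcover (measure_ne_top _ _)).trans (measureReal_biUnion_finset_le _ _)
    _ ≤ ∑ _k : Fin K, Real.exp (-(N * √(1 / (N * n)) * ε ^ 2 / 16)) := by
        refine Finset.sum_le_sum fun k _ => ?_
        have hp : 0 ≤ messageProb n (W k) := activeProb_nonneg _ _
        -- The first message has zero activity, so its threshold is `0` and cannot be missed.
        by_cases hk : (W k : ℕ) = 0
        · have h0 : messageProb n (W k) = 0 := by simp [messageProb, activeProb, stdRate, hk]
          have : E k = ∅ := by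
            refine Set.eq_empty_of_forall_notMem fun D hD => ?_
            simp only [E, h0, Set.mem_ofPred_eq, zero_mul, mul_zero] at hD
            exact absurd hD (Nat.cast_nonneg _).not_gt
          rw [this]
          simpa using (Real.exp_pos _).le
        · refine (tableMeasure_real_singleCount_lt_le hε W hW k).trans (Real.exp_le_exp.2 ?_)
          have := sqrt_inv_le_messageProb hn hN (W k) hk
          gcongr
    _ = _ := by simp

/-! ### From random codebooks to the symbol table -/

/-- The symbols of all codewords in the codebooks of all users. -/
def toTable (C : Fin K → Codebook (InSymbol n) Rmax N) : SymbolTable K n Rmax N :=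
  fun i => C i.1 i.2.1 i.2.2

section RandomCoding

variable (S : Fin K → GenRandomCoding.{u} (InSymbol n) Rmax N
  (fun W => inputDist n (stdRate W)))

lemma measurable_toTable_book :
    Measurable fun θ : (∀ k, (S k).Θ) => toTable fun k => (S k).book (θ k) :=
  measurable_pi_lambda _ fun i =>
    ((S i.1).measurable_symbol i.2.1 i.2.2).comp (measurable_pi_apply i.1)

/-- Independence within each library and across users combine to joint independence of all symbols.
Error and collision probabilities thus do not depend on how the libraries are realized. -/
lemma map_toTable_book :
    (Measure.pi fun k => (S k).γ).map (fun θ => toTable fun k => (S k).book (θ k)) =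
      tableMeasure K n Rmax N := by
  have hX : ∀ k (q : Message Rmax N × Fin N),
      Measurable fun θ : (∀ k, (S k).Θ) => (S k).book (θ k) q.1 q.2 := fun k q =>
    ((S k).measurable_symbol q.1 q.2).comp (measurable_pi_apply k)
  have hmap : ∀ k (q : Message Rmax N × Fin N),
      (Measure.pi fun k => (S k).γ).map (fun θ => (S k).book (θ k) q.1 q.2) =
        (inputDist n (stdRate q.1)).toMeasure := fun k q => by
    rw [← (S k).law q.1 q.2, ← (measurePreserving_eval (fun k => (S k).γ) k).map_eq,
      Measure.map_map ((S k).measurable_symbol q.1 q.2) (measurable_pi_apply k)]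
    rfl
  have hind : iIndepFun (fun (p : Fin K × (Message Rmax N × Fin N)) (θ : ∀ k, (S k).Θ) =>
      (S p.1).book (θ p.1) p.2.1 p.2.2) (Measure.pi fun k => (S k).γ) := by
    refine iIndepFun_uncurry' (X := fun k (q : Message Rmax N × Fin N) (θ : ∀ k, (S k).Θ) =>
      (S k).book (θ k) q.1 q.2) hX ?_ fun k => ?_
    · exact iIndepFun_pi (X := fun k θ (q : Message Rmax N × Fin N) => (S k).book θ q.1 q.2)
        fun k => (measurable_pi_lambda _ fun (q : Message Rmax N × Fin N) => (S k).measurable_symbol q.1 q.2).aemeasurable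
    · have hk := (iIndepFun_iff_map_fun_eq_pi_map
        (fun (p : Message Rmax N × Fin N) => ((S k).measurable_symbol p.1 p.2).aemeasurable)).1 (S k).indep
      refine (iIndepFun_iff_map_fun_eq_pi_map fun q => (hX k q).aemeasurable).2 ?_
      have h1 : (fun q => (Measure.pi fun k => (S k).γ).map
          (fun θ => (S k).book (θ k) q.1 q.2)) =
          fun q : Message Rmax N × Fin N => (S k).γ.map fun θ => (S k).book θ q.1 q.2 :=
        funext fun q => (hmap k q).trans ((S k).law q.1 q.2).symm
      rw [h1, ← hk, ← (measurePreserving_eval (fun k => (S k).γ) k).map_eq, Measure.map_map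
        (measurable_pi_lambda _ fun (q : Message Rmax N × Fin N) => (S k).measurable_symbol q.1 q.2) (measurable_pi_apply k)]
      rfl
  have h := (iIndepFun_iff_map_fun_eq_pi_map fun (p : Fin K × (Message Rmax N × Fin N)) => (hX p.1 p.2).aemeasurable).1 hind
  refine h.trans ?_
  rw [tableMeasure]
  congr 1
  exact funext fun p => hmap p.1 p.2

open Classical in
lemma outputProb_collisionChannel (x : Fin K → Fin N → InSymbol n) (y : Fin N → OutSymbol n) :
    outputProb (collisionChannel K n) x y =
      if y = fun j => collisionOutput fun k => x k j then 1 else 0 := by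
  rw [outputProb]
  split_ifs with h
  · refine Finset.prod_eq_one fun j _ => ?_
    simp [collisionChannel, h]
  · obtain ⟨j, hj⟩ := Function.ne_iff.1 h
    refine Finset.prod_eq_zero (Finset.mem_univ j) ?_
    simp [collisionChannel, PMF.pure_apply, hj]

lemma integral_toTable_book (E : Set (SymbolTable K n Rmax N)) :
    ∫ θ, E.indicator (fun _ => (1 : ℝ)) (toTable fun k => (S k).book (θ k))
      ∂(Measure.pi fun k => (S k).γ) = (tableMeasure K n Rmax N).real E := by
  rw [← integral_indicator_one (MeasurableSet.of_discrete (s := E)), ← map_toTable_book S,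
    integral_map (measurable_toTable_book S).aemeasurable
      (Measurable.of_discrete).aestronglyMeasurable]
  rfl

variable (dec : SymbolTable K n Rmax N → (Fin N → OutSymbol n) →
  Option (Fin K → Message Rmax N)) (W : Fin K → Message Rmax N)

lemma errorProb_collisionChannel :
    errorProb (collisionChannel K n) S (fun C => dec (toTable C)) W =
      (tableMeasure K n Rmax N).real {D | dec D (channelOutput D W) ≠ some W} := by
  classical
  rw [← integral_toTable_book S, errorProb]
  congr 1 with θ
  simp only [condErrorProb, outputProb_collisionChannel, Set.indicator_apply, Set.mem_ofPred_eq]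
  rw [Finset.sum_eq_single (channelOutput (toTable fun k => (S k).book (θ k)) W)]
  · have : channelOutput (toTable fun k => (S k).book (θ k)) W =
      fun j => collisionOutput fun k => (S k).book (θ k) (W k) j := rfl
    simp only [this, if_true]
  · intro y _ hy
    have : y ≠ fun j => collisionOutput fun k => (S k).book (θ k) (W k) j := hy
    simp [this]
  · simp

lemma collisionProb_collisionChannel :
    collisionProb (collisionChannel K n) S (fun C => dec (toTable C)) W =
      (tableMeasure K n Rmax N).real {D | dec D (channelOutput D W) = none} := by
  classical
  rw [← integral_toTable_book S, collisionProb]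
  congr 1 with θ
  simp only [condCollisionProb, outputProb_collisionChannel, Set.indicator_apply,
    Set.mem_ofPred_eq]
  rw [Finset.sum_eq_single (channelOutput (toTable fun k => (S k).book (θ k)) W)]
  · have : channelOutput (toTable fun k => (S k).book (θ k)) W =
      fun j => collisionOutput fun k => (S k).book (θ k) (W k) j := rfl
    simp only [this, if_true]
  · intro y _ hy
    have : y ≠ fun j => collisionOutput fun k => (S k).book (θ k) (W k) j := hy
    simp [this]
  · simp

end RandomCoding

/-! ### The decoder and its asymptotics -/

open Classical in
/-- The decoder that outputs an accepted message vector, if there is one, and otherwise reports a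
collision. -/
noncomputable def marginDecoder (ε : ℝ) (D : SymbolTable K n Rmax N) (y : Fin N → OutSymbol n) :
    Option (Fin K → Message Rmax N) :=
  if h : ∃ W, Accepts ε D y W then some h.choose else none

lemma marginDecoder_error_le (hn : 1 ≤ n) (hN : 1 ≤ N) (hRmax : 0 ≤ Rmax) {ε : ℝ} (hε : 0 < ε)
    (W : Fin K → Message Rmax N) (hW : ∑ k, messageProb n (W k) ≤ 1 - ε) :
    (tableMeasure K n Rmax N).real {D | marginDecoder ε D (channelOutput D W) ≠ some W} ≤
      K * Real.exp (-(N * √(1 / (N * n)) * ε ^ 2 / 16)) +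
        (2 + N * Rmax) ^ K * Real.exp (-(N * √(1 / (N * n)) * ε / 4)) := by
  refine le_trans (measureReal_mono (s₂ := {D | ¬ Accepts ε D (channelOutput D W) W} ∪
    {D | ∃ W', W' ≠ W ∧ Accepts ε D (channelOutput D W) W'}) ?_ (measure_ne_top _ _))
    ((measureReal_union_le _ _).trans (add_le_add
      (tableMeasure_real_not_accepts_self_le hn hN hε.le W hW)
      (tableMeasure_real_exists_accepts_le hn hN hRmax hε W)))
  intro D hD
  by_cases h : Accepts ε D (channelOutput D W) W
  · have hex : ∃ W', Accepts ε D (channelOutput D W) W' := ⟨W, h⟩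
    simp only [marginDecoder, dif_pos hex, Set.mem_ofPred_eq] at hD
    exact Or.inr ⟨_, fun h => hD (congrArg some h), hex.choose_spec⟩
  · exact Or.inl h

lemma one_sub_le_marginDecoder_collision (hn : 1 ≤ n) (hN : 1 ≤ N) (hRmax : 0 ≤ Rmax) {ε : ℝ}
    (hε : 0 < ε) (W : Fin K → Message Rmax N) (hW : 1 - ε < ∑ k, messageProb n (W k)) :
    1 - (2 + N * Rmax) ^ K * Real.exp (-(N * √(1 / (N * n)) * ε / 4)) ≤
      (tableMeasure K n Rmax N).real {D | marginDecoder ε D (channelOutput D W) = none} := by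
  have h1 := probReal_compl_eq_one_sub (μ := tableMeasure K n Rmax N)
    (s := {D | marginDecoder ε D (channelOutput D W) = none}) MeasurableSet.of_discrete
  have hsub : {D : SymbolTable K n Rmax N |
      marginDecoder ε D (channelOutput D W) = none}ᶜ ⊆
      {D | ∃ W', W' ≠ W ∧ Accepts ε D (channelOutput D W) W'} := by
    intro D hD
    simp only [marginDecoder, Set.mem_compl_iff, Set.mem_ofPred_eq] at hD
    split_ifs at hD with hex
    -- The sent vector violates the sum bound, so whatever was accepted is wrong.
    · refine ⟨_, fun h => ?_, hex.choose_spec⟩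
      have := hex.choose_spec.sum_le
      rw [h] at this
      linarith
    · exact absurd rfl hD
  have h2 := (measureReal_mono hsub (measure_ne_top (tableMeasure K n Rmax N) _)).trans
    (tableMeasure_real_exists_accepts_le hn hN hRmax hε W)
  linarith

lemma messageProb_le_sqrt (w : Message Rmax N) : messageProb n w ≤ √(stdRate w / n) :=
  min_le_right _ _

lemma one_le_sum_messageProb (W : Fin K → Message Rmax N)
    (hW : rateVec W ∉ collisionRegion K n) : 1 ≤ ∑ k, messageProb n (W k) := by
  by_contra! h
  refine hW ⟨fun k => stdRate_nonneg _, ?_⟩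
  refine lt_of_eq_of_lt (Finset.sum_congr rfl fun k _ => ?_) h
  rcases min_choice (1 : ℝ) √(stdRate (W k) / n) with h1 | h1
  · have := Finset.single_le_sum (f := fun k => messageProb n (W k))
      (fun k _ => activeProb_nonneg n _) (Finset.mem_univ k)
    simp only [messageProb, activeProb] at this h
    linarith
  · exact h1.symm

/-- As `N √(1/(N n)) = √(N/n)`, the margin must vanish while `√N ε^2` tends to infinity and `√N ε`
outgrows `log N`. The choice `ε = N^(-1/8)` does this; in terms of `m = N^(1/8)` the exponents are
of order `m^2` and `m^3`, against a polynomial factor of order `m^(8 K)`. -/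
lemma tendsto_error_bounds (hn : 1 ≤ n) (hRmax : 0 ≤ Rmax) :
    ∃ ε : ℕ → ℝ, (∀ N, 1 ≤ N → 0 < ε N) ∧ Tendsto ε atTop (𝓝 0) ∧
      Tendsto (fun N : ℕ => K * Real.exp (-(N * √(1 / (N * n)) * ε N ^ 2 / 16))) atTop (𝓝 0) ∧
      Tendsto (fun N : ℕ => (2 + N * Rmax) ^ K * Real.exp (-(N * √(1 / (N * n)) * ε N / 4)))
        atTop (𝓝 0) := by
  have hn' : (1 : ℝ) ≤ n := by exact_mod_cast hn
  let m : ℕ → ℝ := fun N => (N : ℝ) ^ (1 / 8 : ℝ)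
  have hm : Tendsto m atTop atTop :=
    (tendsto_rpow_atTop (by norm_num)).comp tendsto_natCast_atTop_atTop
  have hm0 : ∀ N, 1 ≤ N → 0 < m N := fun N hN => Real.rpow_pos_of_pos (by exact_mod_cast hN) _
  have hm8 : ∀ N : ℕ, (N : ℝ) = m N ^ 8 := fun N => by
    rw [← Real.rpow_natCast, ← Real.rpow_mul (Nat.cast_nonneg N)]
    norm_num
  have hsqrt : ∀ N : ℕ, 1 ≤ N → N * √(1 / (N * n)) = m N ^ 4 * (1 / √n) := fun N hN => by
    have h0 := hm0 N hN
    have h1 : √(1 / (N * n)) = 1 / (m N ^ 4 * √n) := by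
      rw [Real.sqrt_div zero_le_one, Real.sqrt_one, Real.sqrt_mul (Nat.cast_nonneg N), hm8 N,
        show m N ^ 8 = (m N ^ 4) ^ 2 by ring, Real.sqrt_sq (by positivity)]
    have : √(n : ℝ) ≠ 0 := by positivity
    rw [h1, hm8 N]
    field_simp
  have hc : 0 < 1 / √(n : ℝ) := by positivity
  refine ⟨fun N => (m N)⁻¹, fun N hN => inv_pos.2 (hm0 N hN), hm.inv_tendsto_atTop, ?_, ?_⟩
  · have h : Tendsto (fun x : ℝ => K * Real.exp (-(x ^ 2 * (1 / √n / 16)))) atTop (𝓝 0) := by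
      rw [← mul_zero (K : ℝ)]
      refine Tendsto.const_mul _ (Real.tendsto_exp_neg_atTop_nhds_zero.comp ?_)
      exact (tendsto_pow_atTop two_ne_zero).atTop_mul_const (by positivity)
    refine (h.comp hm).congr' ?_
    filter_upwards [eventually_ge_atTop 1] with N hN
    have h0 := hm0 N hN
    simp only [Function.comp, hsqrt N hN]
    congr 3
    field_simp
  · have h : Tendsto (fun x : ℝ => (2 + Rmax) ^ K * (x ^ (8 * K) *
        Real.exp (-(1 / √n / 4) * x))) atTop (𝓝 0) := by
      rw [← mul_zero ((2 + Rmax) ^ K)]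
      refine Tendsto.const_mul _ ?_
      have := tendsto_rpow_mul_exp_neg_mul_atTop_nhds_zero ((8 * K : ℕ) : ℝ) (1 / √n / 4)
        (by positivity)
      simpa only [Real.rpow_natCast] using this
    refine squeeze_zero' (.of_forall fun N => by positivity) ?_ (h.comp hm)
    filter_upwards [eventually_ge_atTop 1, hm.eventually_ge_atTop 1] with N hN h1
    have h0 := hm0 N hN
    simp only [Function.comp, hsqrt N hN]
    rw [pow_mul, ← mul_assoc, ← mul_pow]
    gcongr ?_ ^ K * Real.exp ?_
    · rw [hm8 N]
      have : 1 ≤ m N ^ 8 := one_le_pow₀ h1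
      nlinarith
    · have h2 : m N ^ 4 * (1 / √n) * (m N)⁻¹ / 4 = (1 / √n / 4) * m N ^ 3 := by field_simp
      rw [h2, neg_mul]
      have : m N ≤ m N ^ 3 := le_self_pow₀ h1 (by norm_num)
      gcongr

end RandomAccess

theorem proposition1 (K n : ℕ) (hn : 1 ≤ n) (Rmax : ℝ) (hRmax : 0 < Rmax)
    (S : ∀ (N : ℕ) (_ : Fin K), RandomAccess.GenRandomCoding.{u} (RandomAccess.InSymbol n) Rmax N
      (fun W => RandomAccess.inputDist n (RandomAccess.stdRate W))) :
    RandomAccess.IsAsymptoticallyAchievable (RandomAccess.collisionChannel K n) S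
      (RandomAccess.collisionRegion K n) := by
  obtain ⟨ε, hε0, hε, hA, hB⟩ := RandomAccess.tendsto_error_bounds (K := K) hn hRmax.le
  refine ⟨fun N C => RandomAccess.marginDecoder (ε N) (RandomAccess.toTable C), ?_, ?_⟩
  · intro W r _ hr hrR
    have hAB := hA.add hB
    rw [add_zero] at hAB
    -- The limit point satisfies the strict inequality, so the vanishing margin eventually fits
    -- below `1`.
    have hsum : Tendsto (fun N => ∑ k, √(RandomAccess.rateVec (W N) k / n) + ε N) atTop
        (𝓝 (∑ k, √(r k / n) + 0)) :=
      (tendsto_finsetSum _ fun k _ =>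
        (((continuous_apply k).tendsto r).comp hr).div_const _ |>.sqrt).add hε
    have hsum' : ∀ᶠ N in atTop, ∑ k, √(RandomAccess.rateVec (W N) k / n) + ε N < 1 :=
      hsum.eventually_lt_const (by simpa using hrR.2)
    refine squeeze_zero' (.of_forall fun N => ?_) ?_ hAB
    · rw [RandomAccess.errorProb_collisionChannel]
      exact measureReal_nonneg
    · filter_upwards [eventually_ge_atTop 1, hsum'] with N hN h
      rw [RandomAccess.errorProb_collisionChannel]
      refine RandomAccess.marginDecoder_error_le hn hN hRmax.le (hε0 N hN) (W N) ?_
      have := Finset.sum_le_sum fun k (_ : k ∈ Finset.univ) =>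
        RandomAccess.messageProb_le_sqrt (n := n) (W N k)
      simp only [RandomAccess.rateVec] at h
      linarith
  · intro W r hW _ _
    have hB' := tendsto_const_nhds (x := (1 : ℝ)).sub hB
    rw [sub_zero] at hB'
    refine tendsto_of_tendsto_of_tendsto_of_le_of_le' hB' tendsto_const_nhds ?_
      (.of_forall fun N => ?_)
    · filter_upwards [eventually_ge_atTop 1, hW] with N hN h
      rw [RandomAccess.collisionProb_collisionChannel]
      refine RandomAccess.one_sub_le_marginDecoder_collision hn hN hRmax.le (hε0 N hN) (W N) ?_
      have := RandomAccess.one_le_sum_messageProb (W N) fun h' => h (subset_closure h')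
      linarith [hε0 N hN]
    · rw [RandomAccess.collisionProb_collisionChannel]
      exact measureReal_le_one
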